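/- Let $\Theta\in(0,\pi/2)$ and $\delta\in(0,1)$. Let $$D_\Theta=\{x+iy\in\mathbb C:\ 0<x<\pi,\ |y|<\tan\Theta\,\min(x,\pi-x)\}$$ be the open rhombus with vertices $0$, $\pi$ and $\frac{\pi}{2}(1\pm i\tan\Theta)$, let $\rho_\delta(s)=|s|^\delta|\pi-s|^\delta$, and let $A^2_\delta(D_\Theta)$ be the weighted Bergman space of all holomorphic functions $f:D_\Theta\to\mathbb C$ with $$\|f\|^2_{A^2_\delta(D_\Theta)}=\int_{D_\Theta}|f(s)|^2\rho_\delta(s)\,\mathrm dA(s)<\infty,$$ where $\mathrm dA$ is the two-dimensional Lebesgue measure. Let $W_0^{1,2}(0,\pi)$ be the closure of $C_c^\infty(0,\pi)$ in the complex Sobolev space $W^{1,2}(0,\pi)$, with norm $(\|\xi\|_{L^2}^2+\|\xi'\|_{L^2}^2)^{1/2}$, and let $W^{-1,2}(0,\pi)$ be its dual space with the dual norm. Then: 1. There is a constant $C_{\Theta,\delta}>0$, depending only on $\Theta$ and $\delta$, such that for every $f\in A^2_\delta(D_\Theta)$ the integral on the left-hand side below is finite and $$\int_0^\pi t^{1+\delta}(\pi-t)^{1+\delta}|f(t)|^2\,\mathrm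 dt\le C_{\Theta,\delta}\,\|f\|^2_{A^2_\delta(D_\Theta)}.$$ 2. $A^2_\delta(D_\Theta)$ is contained, with continuous inclusion, in $W^{-1,2}(0,\pi)$: for all $f\in A^2_\delta(D_\Theta)$ and $\xi\in W_0^{1,2}(0,\pi)$ the product $f\xi$ is integrable on $(0,\pi)$, and $f\mapsto\big(\xi\mapsto\int_0^\pi f(x)\xi(x)\,\mathrm dx\big)$ is an injective continuous linear map from $A^2_\delta(D_\Theta)$ to $W^{-1,2}(0,\pi)$. -/

import Mathlib

open MeasureTheory

noncomputable section

/-- The open rhombus `D_Θ` with opposite vertices `0` and `π` and with angle `2Θ` at `0`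
(the other two vertices are `(π/2)(1 ± i tan Θ)`), for `0 < Θ < π/2`. -/
def rhombus (Θ : ℝ) : Set ℂ :=
  {s : ℂ | 0 < s.re ∧ s.re < Real.pi ∧ |s.im| < Real.tan Θ * min s.re (Real.pi - s.re)}

/-- The weight `ρ_δ(s) = |s|^δ |π - s|^δ`. -/
def bergmanWeight (δ : ℝ) (s : ℂ) : ℝ :=
  ‖s‖ ^ δ * ‖(Real.pi : ℂ) - s‖ ^ δ

theorem isOpen_rhombus (Θ : ℝ) : IsOpen (rhombus Θ) := by
  have h1 : IsOpen {s : ℂ | 0 < s.re} := isOpen_lt (by fun_prop) (by fun_prop)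
  have h2 : IsOpen {s : ℂ | s.re < Real.pi} := isOpen_lt (by fun_prop) (by fun_prop)
  have h3 : IsOpen {s : ℂ | |s.im| < Real.tan Θ * min s.re (Real.pi - s.re)} :=
    isOpen_lt (by fun_prop) (by fun_prop)
  exact h1.inter (h2.inter h3)

theorem bergmanWeight_nonneg (δ : ℝ) (s : ℂ) : 0 ≤ bergmanWeight δ s := by
  unfold bergmanWeight
  positivity

theorem bergmanWeight_pos (Θ δ : ℝ) {s : ℂ} (hs : s ∈ rhombus Θ) : 0 < bergmanWeight δ s := by
  have h0 : 0 < ‖s‖ := by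
    rw [norm_pos_iff]
    rintro rfl
    exact lt_irrefl _ hs.1
  have h1 : 0 < ‖(Real.pi : ℂ) - s‖ := by
    rw [norm_pos_iff, sub_ne_zero]
    rintro rfl
    exact lt_irrefl _ hs.2.1
  unfold bergmanWeight
  positivity

theorem measurable_bergmanWeight (δ : ℝ) : Measurable (bergmanWeight δ) := by
  unfold bergmanWeight
  fun_prop

theorem bergman_integrableOn_mul (Θ δ : ℝ) {f g : ℂ → ℂ}
    (hf : ContinuousOn f (rhombus Θ)) (hg : ContinuousOn g (rhombus Θ))
    (hf2 : IntegrableOn (fun s ↦ ‖f s‖ ^ 2 * bergmanWeight δ s) (rhombus Θ))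
    (hg2 : IntegrableOn (fun s ↦ ‖g s‖ ^ 2 * bergmanWeight δ s) (rhombus Θ)) :
    IntegrableOn (fun s ↦ starRingEnd ℂ (f s) * g s * (bergmanWeight δ s : ℂ)) (rhombus Θ) := by
  have hm := (isOpen_rhombus Θ).measurableSet
  refine Integrable.mono' (hf2.add hg2) ?_ (Filter.Eventually.of_forall fun s ↦ ?_)
  · refine AEStronglyMeasurable.mul (AEStronglyMeasurable.mul ?_ ?_) ?_
    · exact (Complex.continuous_conj.comp_continuousOn hf).aestronglyMeasurable hm
    · exact hg.aestronglyMeasurable hm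
    · exact (Complex.measurable_ofReal.comp (measurable_bergmanWeight δ)).aestronglyMeasurable
  · have hw := bergmanWeight_nonneg δ s
    simp only [norm_mul, RCLike.norm_conj, Complex.norm_real, Real.norm_eq_abs, abs_of_nonneg hw,
      Pi.add_apply]
    nlinarith [mul_nonneg hw (sq_nonneg (‖f s‖ - ‖g s‖)), mul_nonneg hw (sq_nonneg ‖f s‖),
      mul_nonneg hw (sq_nonneg ‖g s‖)]

/-- The weighted Bergman space `A²_δ(D_Θ)` as a space of functions: holomorphic functions on `D_Θ`
that are square integrable for `ρ_δ dA`. So that equality is equality on `D_Θ`, such a function is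
represented by its extension by zero to `ℂ`. -/
def bergmanSubmodule (Θ δ : ℝ) : Submodule ℂ (ℂ → ℂ) where
  carrier := {f | DifferentiableOn ℂ f (rhombus Θ) ∧
    IntegrableOn (fun s ↦ ‖f s‖ ^ 2 * bergmanWeight δ s) (rhombus Θ) ∧ ∀ s ∉ rhombus Θ, f s = 0}
  zero_mem' := ⟨differentiableOn_const 0, by simp, fun _ _ ↦ rfl⟩
  add_mem' := by
    rintro f g ⟨hf, hf2, hf0⟩ ⟨hg, hg2, hg0⟩
    refine ⟨hf.add hg, ?_, fun s hs ↦ by simp [hf0 s hs, hg0 s hs]⟩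
    refine Integrable.mono' ((hf2.add hg2).const_mul 2) ?_ (Filter.Eventually.of_forall fun s ↦ ?_)
    · exact (((hf.add hg).continuousOn.norm.pow 2).aestronglyMeasurable
        (isOpen_rhombus Θ).measurableSet).mul (measurable_bergmanWeight δ).aestronglyMeasurable
    · have hw := bergmanWeight_nonneg δ s
      have h1 : ‖f s + g s‖ ^ 2 ≤ 2 * (‖f s‖ ^ 2 + ‖g s‖ ^ 2) := by
        have := norm_add_le (f s) (g s)
        nlinarith [sq_nonneg (‖f s‖ - ‖g s‖), norm_nonneg (f s + g s)]
      rw [Real.norm_eq_abs, abs_of_nonneg (by positivity)]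
      simp only [Pi.add_apply]
      nlinarith [mul_le_mul_of_nonneg_right h1 hw]
  smul_mem' := by
    rintro c f ⟨hf, hf2, hf0⟩
    refine ⟨hf.const_smul c, ?_, fun s hs ↦ by simp [hf0 s hs]⟩
    refine (hf2.const_mul (‖c‖ ^ 2)).congr (Filter.Eventually.of_forall fun s ↦ ?_)
    simp only [Pi.smul_apply, smul_eq_mul, norm_mul]
    ring

/-- The weighted Bergman space `A²_δ(D_Θ)`, as a type carrying the norm defined below. -/
def WeightedBergman (Θ δ : ℝ) : Type :=
  bergmanSubmodule Θ δ

instance (Θ δ : ℝ) : AddCommGroup (WeightedBergman Θ δ) :=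
  inferInstanceAs (AddCommGroup (bergmanSubmodule Θ δ))

instance (Θ δ : ℝ) : Module ℂ (WeightedBergman Θ δ) :=
  inferInstanceAs (Module ℂ (bergmanSubmodule Θ δ))

instance (Θ δ : ℝ) : CoeFun (WeightedBergman Θ δ) (fun _ ↦ ℂ → ℂ) :=
  ⟨fun f ↦ f.1⟩

/-- The inner product `∫_{D_Θ} g(s) \overline{f(s)} ρ_δ(s) dA(s)` of `A²_δ(D_Θ)` (linear in `g`). -/
@[reducible] def bergmanCore (Θ δ : ℝ) : InnerProductSpace.Core ℂ (WeightedBergman Θ δ) where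
  inner f g := ∫ s in rhombus Θ, starRingEnd ℂ (f s) * g s * (bergmanWeight δ s : ℂ)
  conj_inner_symm f g := by
    rw [← integral_conj]
    refine integral_congr_ae (Filter.Eventually.of_forall fun s ↦ ?_)
    simp only [map_mul, Complex.conj_conj, Complex.conj_ofReal]
    ring
  re_inner_nonneg f := by
    have : (∫ s in rhombus Θ, starRingEnd ℂ (f s) * f s * (bergmanWeight δ s : ℂ))
        = ((∫ s in rhombus Θ, ‖f s‖ ^ 2 * bergmanWeight δ s : ℝ) : ℂ) := by
      rw [← integral_complex_ofReal]
      refine integral_congr_ae (Filter.Eventually.of_forall fun s ↦ ?_)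
      simp [Complex.conj_mul']
    rw [this]
    exact integral_nonneg fun s ↦ mul_nonneg (sq_nonneg _) (bergmanWeight_nonneg δ s)
  add_left f g h := by
    rw [← integral_add
      (bergman_integrableOn_mul Θ δ f.2.1.continuousOn h.2.1.continuousOn f.2.2.1 h.2.2.1)
      (bergman_integrableOn_mul Θ δ g.2.1.continuousOn h.2.1.continuousOn g.2.2.1 h.2.2.1)]
    refine integral_congr_ae (Filter.Eventually.of_forall fun s ↦ ?_)
    change starRingEnd ℂ (f s + g s) * h s * _ = _
    simp only [map_add]
    ring
  smul_left f g c := by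
    rw [← integral_const_mul]
    refine integral_congr_ae (Filter.Eventually.of_forall fun s ↦ ?_)
    change starRingEnd ℂ (c * f s) * g s * _ = _
    simp only [map_mul]
    ring
  definite f hf := by
    have hop := isOpen_rhombus Θ
    have h1 : (∫ s in rhombus Θ, starRingEnd ℂ (f s) * f s * (bergmanWeight δ s : ℂ))
        = ((∫ s in rhombus Θ, ‖f s‖ ^ 2 * bergmanWeight δ s : ℝ) : ℂ) := by
      rw [← integral_complex_ofReal]
      refine integral_congr_ae (Filter.Eventually.of_forall fun s ↦ ?_)
      simp [Complex.conj_mul']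
    have h2 : (∫ s in rhombus Θ, ‖f s‖ ^ 2 * bergmanWeight δ s) = 0 := by
      rw [h1] at hf
      exact_mod_cast hf
    rw [integral_eq_zero_iff_of_nonneg
      (fun s ↦ mul_nonneg (sq_nonneg _) (bergmanWeight_nonneg δ s)) f.2.2.1] at h2
    have h3 : (f : ℂ → ℂ) =ᵐ[volume.restrict (rhombus Θ)] fun _ ↦ 0 := by
      filter_upwards [h2, ae_restrict_mem hop.measurableSet] with s hs hsD
      have := bergmanWeight_pos Θ δ hsD
      simpa [this.ne'] using hs
    have h4 := Measure.eqOn_open_of_ae_eq h3 hop f.2.1.continuousOn continuousOn_const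
    apply Subtype.ext
    funext s
    by_cases hs : s ∈ rhombus Θ
    · exact h4 hs
    · exact f.2.2.2 s hs

instance (Θ δ : ℝ) : NormedAddCommGroup (WeightedBergman Θ δ) :=
  (bergmanCore Θ δ).toNormedAddCommGroup

instance (Θ δ : ℝ) : InnerProductSpace ℂ (WeightedBergman Θ δ) :=
  InnerProductSpace.ofCore (bergmanCore Θ δ).toCore

/-- The squared norm of `A²_δ(D_Θ)` is `∫_{D_Θ} |f(s)|² ρ_δ(s) dA(s)`. -/
theorem WeightedBergman.norm_sq_eq (Θ δ : ℝ) (f : WeightedBergman Θ δ) :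
    ‖f‖ ^ 2 = ∫ s in rhombus Θ, ‖f s‖ ^ 2 * bergmanWeight δ s := by
  have h1 : (∫ s in rhombus Θ, starRingEnd ℂ (f s) * f s * (bergmanWeight δ s : ℂ))
      = ((∫ s in rhombus Θ, ‖f s‖ ^ 2 * bergmanWeight δ s : ℝ) : ℂ) := by
    rw [← integral_complex_ofReal]
    refine integral_congr_ae (Filter.Eventually.of_forall fun s ↦ ?_)
    simp [Complex.conj_mul']
  rw [← inner_self_eq_norm_sq (𝕜 := ℂ) f]
  change RCLike.re (∫ s in rhombus Θ, starRingEnd ℂ (f s) * f s * (bergmanWeight δ s : ℂ)) = _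
  rw [h1]
  rfl

/-- The complex space `L²(0,π)`. -/
abbrev L2Interval : Type :=
  Lp ℂ 2 (volume.restrict (Set.Ioo (0 : ℝ) Real.pi))

/-- The pairs `(φ, φ')` with `φ ∈ C_c^∞(0,π)`, in the Hilbert space `L²(0,π) × L²(0,π)` with norm
`‖(u,v)‖² = ‖u‖² + ‖v‖²`; on such pairs this is the norm of `W^{1,2}(0,π)`. -/
def testPairs : Submodule ℂ (WithLp 2 (L2Interval × L2Interval)) where
  carrier := {p | ∃ φ : ℝ → ℂ, ContDiff ℝ (⊤ : ℕ∞) φ ∧ HasCompactSupport φ ∧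
    tsupport φ ⊆ Set.Ioo (0 : ℝ) Real.pi ∧
    p.fst =ᵐ[volume.restrict (Set.Ioo (0 : ℝ) Real.pi)] φ ∧
    p.snd =ᵐ[volume.restrict (Set.Ioo (0 : ℝ) Real.pi)] deriv φ}
  zero_mem' := by
    refine ⟨0, contDiff_const, HasCompactSupport.zero, by simp [tsupport], Lp.coeFn_zero _ _ _, ?_⟩
    have h : deriv (0 : ℝ → ℂ) = 0 := by
      funext x
      exact deriv_const x 0
    rw [h]
    exact Lp.coeFn_zero _ _ _
  add_mem' := by
    rintro p q ⟨φ, h1, h2, h3, h4, h5⟩ ⟨ψ, k1, k2, k3, k4, k5⟩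
    refine ⟨φ + ψ, h1.add k1, h2.add k2,
      (tsupport_add φ ψ).trans (Set.union_subset h3 k3), ?_, ?_⟩
    · exact (Lp.coeFn_add _ _).trans (h4.add k4)
    · have h : deriv (φ + ψ) = deriv φ + deriv ψ := by
        funext x
        exact deriv_add (h1.differentiable (by simp) x) (k1.differentiable (by simp) x)
      rw [h]
      exact (Lp.coeFn_add _ _).trans (h5.add k5)
  smul_mem' := by
    rintro c p ⟨φ, h1, h2, h3, h4, h5⟩
    refine ⟨c • φ, contDiff_const.smul h1, h2.smul_left (f := fun _ ↦ c),
      (closure_mono (Function.support_const_smul_subset c φ)).trans h3, ?_, ?_⟩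
    · exact (Lp.coeFn_smul _ _).trans (h4.const_smul c)
    · have h : deriv (c • φ) = c • deriv φ := by
        funext x
        exact deriv_const_smul c (h1.differentiable (by simp) x)
      rw [h]
      exact (Lp.coeFn_smul _ _).trans (h5.const_smul c)

/-- The Sobolev space `W_0^{1,2}(0,π)`: the closure of `C_c^∞(0,π)` for the norm of `W^{1,2}(0,π)`,
an element `ξ` being recorded together with its weak derivative as the pair `(ξ, ξ')`. -/
abbrev SobolevZero : Type :=
  testPairs.topologicalClosure

/-- The function in `L²(0,π)` underlying an element of `W_0^{1,2}(0,π)`. -/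
def SobolevZero.toL2 (ξ : SobolevZero) : L2Interval :=
  (ξ : WithLp 2 (L2Interval × L2Interval)).fst

/-- The Sobolev space `W^{-1,2}(0,π)`: the dual of `W_0^{1,2}(0,π)`, with the dual norm; a function
`h` on `(0,π)` is identified with the functional `ξ ↦ ∫_0^π h ξ`. -/
abbrev SobolevNeg : Type :=
  StrongDual ℂ SobolevZero

end

/-! Write d(t) = min(t, π - t) and w(t) = t^(1+δ) (π - t)^(1+δ). For small κ the disc of radius κ
d(t) about t ∈ (0,π) lies in the rhombus, and ρ_δ is at least 4^(-δ) t^δ (π - t)^δ on it. The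
sub-mean value property of |f|² then bounds w(t) |f(t)|² by a constant times d(t)⁻¹ times the
integral of |f|² ρ_δ over that disc: the area costs d(t)⁻², and the extra factor t (π - t) ≤ π d(t)
gains one power back (`WeightedBergman.ofReal_le_lintegral_ball`). After integration in t and
Tonelli, a point s is seen only by those t whose distance from Re s is less than κ d(t), and the
integral of dt / d(t) over these is bounded uniformly in s (`lintegral_endDist_kernel_le`). This is
the weighted estimate.

The embedding is its dual. Integrating ξ' from the nearer end point gives |ξ(t)|² ≤ d(t) ‖ξ‖², so ∫
|ξ|² / w is controlled by the integral of d^(-δ), finite because δ < 1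
(`SobolevZero.lintegral_div_le`). Cauchy–Schwarz with weights w and 1/w bounds the pairing.
Injectivity follows by testing against smooth functions and applying the identity theorem. -/

/-! ### Sub-mean value property of |f|² -/

theorem enorm_sq_mul_le_lintegral_circleMap {f : ℂ → ℂ} {c : ℂ} {R : ℝ}
    (hf : DiffContOnCl ℂ f (Metric.ball c |R|)) :
    ENNReal.ofReal (2 * Real.pi) * ‖f c‖ₑ ^ 2
      ≤ ∫⁻ θ in Set.Ioo (-Real.pi) Real.pi, ‖f (circleMap c R θ)‖ₑ ^ 2 := by
  -- The mean value property is applied to the holomorphic function f²; taking norms gives |f|².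
  have hsq : DiffContOnCl ℂ (fun z ↦ f z * f z) (Metric.ball c |R|) := hf.smul hf
  have hmean := hsq.circleAverage
  -- Periodicity moves the angle from (0, 2π) to (-π, π), the range used by `polarCoord`.
  have hper : Function.Periodic (fun θ ↦ f (circleMap c R θ) * f (circleMap c R θ))
      (2 * Real.pi) := fun θ ↦ by simp only [periodic_circleMap c R θ]
  have hshift := hper.intervalIntegral_add_eq 0 (-Real.pi)
  rw [zero_add, show -Real.pi + 2 * Real.pi = Real.pi by ring] at hshift
  rw [Real.circleAverage, hshift, inv_smul_eq_iff₀ Real.two_pi_pos.ne',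
    intervalIntegral.integral_of_le (by linarith [Real.pi_pos])] at hmean
  calc ENNReal.ofReal (2 * Real.pi) * ‖f c‖ₑ ^ 2 = ‖(2 * Real.pi) • (f c * f c)‖ₑ := by
        rw [enorm_smul, enorm_mul (f c), sq, Real.enorm_eq_ofReal Real.two_pi_pos.le]
    _ ≤ ∫⁻ θ in Set.Ioc (-Real.pi) Real.pi, ‖f (circleMap c R θ) * f (circleMap c R θ)‖ₑ := by
        rw [← hmean]
        exact enorm_integral_le_lintegral_enorm _
    _ = _ := by
        rw [restrict_Ioo_eq_restrict_Ioc]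
        simp only [enorm_mul, sq]

/-- The sub-mean value property of `|f|²` on discs, for `f` holomorphic. -/
theorem enorm_sq_mul_le_lintegral_ball {f : ℂ → ℂ} (hm : Measurable f) {c : ℂ} {r : ℝ}
    (hr : 0 ≤ r) (hf : DifferentiableOn ℂ f (Metric.ball c r)) :
    ENNReal.ofReal (Real.pi * r ^ 2) * ‖f c‖ₑ ^ 2
      ≤ ∫⁻ s in Metric.ball c r, ‖f s‖ₑ ^ 2 := by
  set g : ℂ → ENNReal := (Metric.ball c r).indicator fun s ↦ ‖f s‖ₑ ^ 2 with hg
  have hgm : Measurable g := (hm.enorm.pow_const 2).indicator measurableSet_ball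
  have hsymm : Measurable fun p : ℝ × ℝ ↦ c + Complex.polarCoord.symm p := by
    simp only [Complex.polarCoord_symm_apply]
    fun_prop
  have hpolar : ∀ p : ℝ × ℝ, c + Complex.polarCoord.symm p = circleMap c p.1 p.2 := by
    intro p
    rw [Complex.polarCoord_symm_apply, circleMap, Complex.exp_mul_I]
    simp
  have hradial : ∫⁻ ρ in Set.Ioo 0 r, ENNReal.ofReal ρ = ENNReal.ofReal (r ^ 2 / 2) := by
    rw [← ofReal_integral_eq_lintegral_ofReal, restrict_Ioo_eq_restrict_Ioc,
      ← intervalIntegral.integral_of_le hr, integral_id]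
    · simp
    · exact (continuous_id.integrableOn_Icc (a := 0) (b := r)).mono_set Set.Ioo_subset_Icc_self
    · filter_upwards [ae_restrict_mem measurableSet_Ioo] with ρ hρ using hρ.1.le
  calc ENNReal.ofReal (Real.pi * r ^ 2) * ‖f c‖ₑ ^ 2
      = ∫⁻ ρ in Set.Ioo 0 r, ENNReal.ofReal ρ * (ENNReal.ofReal (2 * Real.pi) * ‖f c‖ₑ ^ 2) := by
        rw [lintegral_mul_const _ ENNReal.measurable_ofReal, hradial, ← mul_assoc,
          ← ENNReal.ofReal_mul (by positivity)]
        congr 2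
        ring
    _ ≤ ∫⁻ ρ in Set.Ioo 0 r, ENNReal.ofReal ρ *
          ∫⁻ θ in Set.Ioo (-Real.pi) Real.pi, g (circleMap c ρ θ) := by
        refine setLIntegral_mono' measurableSet_Ioo fun ρ hρ ↦ ?_
        gcongr
        have habs : |ρ| < r := by rw [abs_of_pos hρ.1]; exact hρ.2
        refine (enorm_sq_mul_le_lintegral_circleMap (R := ρ) ?_).trans_eq ?_
        · refine DifferentiableOn.diffContOnCl (hf.mono ?_)
          exact Metric.closure_ball_subset_closedBall.trans (Metric.closedBall_subset_ball habs)
        · refine lintegral_congr fun θ ↦ ?_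
          rw [hg, Set.indicator_of_mem]
          rw [Metric.mem_ball, dist_eq_norm, circleMap_sub_center, norm_circleMap_zero]
          exact habs
    _ ≤ ∫⁻ ρ in Set.Ioi 0, ENNReal.ofReal ρ *
          ∫⁻ θ in Set.Ioo (-Real.pi) Real.pi, g (circleMap c ρ θ) :=
        lintegral_mono_set fun ρ hρ ↦ hρ.1
    _ = ∫⁻ p in polarCoord.target, ENNReal.ofReal p.1 • g (c + Complex.polarCoord.symm p) := by
        have htarget : polarCoord.target = Set.Ioi (0 : ℝ) ×ˢ Set.Ioo (-Real.pi) Real.pi := rfl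
        rw [htarget, Measure.volume_eq_prod, ← Measure.prod_restrict, lintegral_prod]
        · refine lintegral_congr fun ρ ↦ ?_
          simp only [smul_eq_mul, hpolar]
          exact (lintegral_const_mul' _ _ ENNReal.ofReal_ne_top).symm
        · exact (measurable_fst.ennreal_ofReal.mul (hgm.comp hsymm)).aemeasurable
    _ = ∫⁻ s, g (c + s) := Complex.lintegral_comp_polarCoord_symm fun s ↦ g (c + s)
    _ = ∫⁻ s, g s := lintegral_add_left_eq_self g c
    _ = _ := by rw [hg, lintegral_indicator measurableSet_ball]

/-! ### Geometry of the discs of radius κ d(t) -/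

/-- The distance from `t ∈ (0,π)` to the end points of that interval. -/
noncomputable def endDist (t : ℝ) : ℝ := min t (Real.pi - t)

theorem continuous_endDist : Continuous endDist := by unfold endDist; fun_prop

theorem endDist_pos {t : ℝ} (ht : t ∈ Set.Ioo 0 Real.pi) : 0 < endDist t :=
  lt_min ht.1 (sub_pos.2 ht.2)

theorem abs_endDist_sub_le (t x : ℝ) : |endDist t - endDist x| ≤ |t - x| := by
  unfold endDist
  refine (abs_min_sub_min_le_max t (Real.pi - t) x (Real.pi - x)).trans (max_le le_rfl ?_)
  rw [abs_sub_comm t x]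
  exact le_of_eq (by congr 1; ring)

theorem endDist_le_mul {t : ℝ} (ht : t ∈ Set.Ioo 0 Real.pi) :
    endDist t * (Real.pi / 2) ≤ t * (Real.pi - t) := by
  obtain ⟨h0, h1⟩ := ht
  unfold endDist
  rcases le_total t (Real.pi - t) with h | h
  · rw [min_eq_left h]
    nlinarith
  · rw [min_eq_right h]
    nlinarith

theorem mul_le_endDist {t : ℝ} (ht : t ∈ Set.Ioo 0 Real.pi) :
    t * (Real.pi - t) ≤ Real.pi * endDist t := by
  obtain ⟨h0, h1⟩ := ht
  unfold endDist
  rcases le_total t (Real.pi - t) with h | h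
  · rw [min_eq_left h]
    nlinarith
  · rw [min_eq_right h]
    nlinarith

theorem mem_rhombus_iff {Θ : ℝ} {s : ℂ} :
    s ∈ rhombus Θ ↔ s.re ∈ Set.Ioo 0 Real.pi ∧ |s.im| < Real.tan Θ * endDist s.re :=
  and_assoc.symm

/-- Since `endDist` is 1-Lipschitz, it is at least (1 - κ) d(t) at Re s, so the second condition on
κ is what bounds |Im s| < κ d(t) by the height of the rhombus there. -/
theorem ball_subset_rhombus {Θ κ t : ℝ} (hκ1 : κ < 1)
    (hκ2 : κ ≤ Real.tan Θ * (1 - κ)) (ht : t ∈ Set.Ioo 0 Real.pi) :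
    Metric.ball (t : ℂ) (κ * endDist t) ⊆ rhombus Θ := by
  intro s hs
  have hm := endDist_pos ht
  rw [Metric.mem_ball, dist_eq_norm] at hs
  have hre : |s.re - t| < κ * endDist t := by
    simpa using (Complex.abs_re_le_norm (s - t)).trans_lt hs
  have him : |s.im| < κ * endDist t := by
    simpa using (Complex.abs_im_le_norm (s - t)).trans_lt hs
  have hκ0 : 0 < κ := pos_of_mul_pos_left ((abs_nonneg _).trans_lt him) hm.le
  have hlip := abs_endDist_sub_le s.re t
  have hlow : (1 - κ) * endDist t ≤ endDist s.re := by
    linarith [(abs_le.1 hlip).1]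
  have hpos : 0 < endDist s.re := (mul_pos (by linarith) hm).trans_le hlow
  have htan : 0 ≤ Real.tan Θ := by
    by_contra! h
    nlinarith
  refine mem_rhombus_iff.2 ⟨⟨?_, ?_⟩, ?_⟩
  · exact hpos.trans_le (min_le_left _ _)
  · linarith [hpos.trans_le (min_le_right s.re (Real.pi - s.re))]
  · calc |s.im| < κ * endDist t := him
      _ ≤ Real.tan Θ * (1 - κ) * endDist t := by gcongr
      _ ≤ Real.tan Θ * endDist s.re := by rw [mul_assoc]; gcongr

/-- The radius is at most half the distance from t to either end point, so |s| ≥ t/2 and |π - s| ≥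
(π - t)/2; each factor costs 2^δ. -/
theorem rpow_le_mul_bergmanWeight {δ κ t : ℝ} (hδ : 0 ≤ δ) (hκ : κ ≤ 1 / 2)
    (ht : t ∈ Set.Ioo 0 Real.pi) {s : ℂ} (hs : s ∈ Metric.ball (t : ℂ) (κ * endDist t)) :
    t ^ δ * (Real.pi - t) ^ δ ≤ 4 ^ δ * bergmanWeight δ s := by
  have hm := endDist_pos ht
  obtain ⟨h0, h1⟩ := ht
  rw [Metric.mem_ball, dist_eq_norm] at hs
  have hs' : ‖s - t‖ ≤ endDist t / 2 := by nlinarith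
  have hl : endDist t ≤ t := min_le_left _ _
  have hr : endDist t ≤ Real.pi - t := min_le_right _ _
  have hnt : ‖(t : ℂ)‖ = t := by rw [Complex.norm_real, Real.norm_eq_abs, abs_of_pos h0]
  have hnp : ‖(Real.pi : ℂ) - t‖ = Real.pi - t := by
    rw [← Complex.ofReal_sub, Complex.norm_real, Real.norm_eq_abs, abs_of_pos (by linarith)]
  have ha : t ≤ 2 * ‖s‖ := by
    have := norm_sub_norm_le (t : ℂ) s
    rw [norm_sub_rev, hnt] at this
    linarith
  have hb : Real.pi - t ≤ 2 * ‖(Real.pi : ℂ) - s‖ := by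
    have := norm_sub_norm_le ((Real.pi : ℂ) - t) ((Real.pi : ℂ) - s)
    rw [hnp, sub_sub_sub_cancel_left] at this
    linarith
  have h4 : (4 : ℝ) ^ δ = 2 ^ δ * 2 ^ δ := by
    rw [← Real.mul_rpow (by norm_num) (by norm_num)]; norm_num
  calc t ^ δ * (Real.pi - t) ^ δ ≤ (2 * ‖s‖) ^ δ * (2 * ‖(Real.pi : ℂ) - s‖) ^ δ := by
        gcongr
    _ = 4 ^ δ * bergmanWeight δ s := by
        rw [Real.mul_rpow (by norm_num) (norm_nonneg _), Real.mul_rpow (by norm_num) (norm_nonneg _),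
          h4, bergmanWeight]
        ring

/-! ### The weighted restriction estimate -/

theorem WeightedBergman.measurable {Θ δ : ℝ} (f : WeightedBergman Θ δ) :
    Measurable (f : ℂ → ℂ) := by
  classical
  have h := f.2.1.continuousOn.measurable_piecewise
    (continuousOn_const (c := (0 : ℂ)) (s := (rhombus Θ)ᶜ)) (isOpen_rhombus Θ).measurableSet
  convert h using 1
  funext s
  by_cases hs : s ∈ rhombus Θ
  · simp [hs]
  · simpa [hs] using f.2.2.2 s hs

theorem WeightedBergman.lintegral_eq {Θ δ : ℝ} (f : WeightedBergman Θ δ) :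
    ∫⁻ s in rhombus Θ, ENNReal.ofReal (‖f s‖ ^ 2 * bergmanWeight δ s)
      = ENNReal.ofReal (‖f‖ ^ 2) := by
  rw [WeightedBergman.norm_sq_eq]
  exact (ofReal_integral_eq_lintegral_ofReal f.2.2.1 (Filter.Eventually.of_forall fun s ↦
    mul_nonneg (sq_nonneg _) (bergmanWeight_nonneg δ s))).symm

/-- The pointwise bound from the sub-mean value property on a disc of radius `κ d(t)` around `t`. -/
theorem WeightedBergman.ofReal_le_lintegral_ball {Θ δ κ t : ℝ} (hδ : 0 ≤ δ) (hκ0 : 0 < κ)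
    (hκ1 : κ ≤ 1 / 2) (hκ2 : κ ≤ Real.tan Θ * (1 - κ)) (ht : t ∈ Set.Ioo 0 Real.pi)
    (f : WeightedBergman Θ δ) :
    ENNReal.ofReal (t ^ (1 + δ) * (Real.pi - t) ^ (1 + δ) * ‖f (t : ℂ)‖ ^ 2)
      ≤ ENNReal.ofReal (4 ^ δ / (κ ^ 2 * endDist t)) *
        ∫⁻ s in Metric.ball (t : ℂ) (κ * endDist t),
          ENNReal.ofReal (‖f s‖ ^ 2 * bergmanWeight δ s) := by
  have hm := endDist_pos ht
  have hpi := Real.pi_pos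
  have hsub := ball_subset_rhombus (by linarith) hκ2 ht
  have hsq : ∀ z : ℂ, ‖z‖ₑ ^ 2 = ENNReal.ofReal (‖z‖ ^ 2) := fun z ↦ by
    rw [ENNReal.ofReal_pow (norm_nonneg _), ofReal_norm]
  have h0 : 0 < t := ht.1
  have h1 : 0 < Real.pi - t := sub_pos.2 ht.2
  have hmean := enorm_sq_mul_le_lintegral_ball f.measurable (mul_pos hκ0 hm).le (f.2.1.mono hsub)
  have hcoef : t ^ (1 + δ) * (Real.pi - t) ^ (1 + δ) * ‖f (t : ℂ)‖ ^ 2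
      ≤ 1 / (κ ^ 2 * endDist t) * (t ^ δ * (Real.pi - t) ^ δ) *
        (Real.pi * (κ * endDist t) ^ 2 * ‖f (t : ℂ)‖ ^ 2) := by
    have : 1 / (κ ^ 2 * endDist t) * (t ^ δ * (Real.pi - t) ^ δ) *
        (Real.pi * (κ * endDist t) ^ 2 * ‖f (t : ℂ)‖ ^ 2)
        = (Real.pi * endDist t) * (t ^ δ * (Real.pi - t) ^ δ * ‖f (t : ℂ)‖ ^ 2) := by
      field_simp
    rw [this, Real.rpow_add h0, Real.rpow_add h1, Real.rpow_one, Real.rpow_one]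
    calc t * t ^ δ * ((Real.pi - t) * (Real.pi - t) ^ δ) * ‖f (t : ℂ)‖ ^ 2
        = (t * (Real.pi - t)) * (t ^ δ * (Real.pi - t) ^ δ * ‖f (t : ℂ)‖ ^ 2) := by ring
      _ ≤ _ := mul_le_mul_of_nonneg_right (mul_le_endDist ht) (by positivity)
  calc ENNReal.ofReal (t ^ (1 + δ) * (Real.pi - t) ^ (1 + δ) * ‖f (t : ℂ)‖ ^ 2)
      ≤ ENNReal.ofReal (1 / (κ ^ 2 * endDist t) * (t ^ δ * (Real.pi - t) ^ δ)) *
        (ENNReal.ofReal (Real.pi * (κ * endDist t) ^ 2) * ‖f (t : ℂ)‖ₑ ^ 2) := by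
        rw [hsq, ← ENNReal.ofReal_mul (by positivity), ← ENNReal.ofReal_mul (by positivity)]
        exact ENNReal.ofReal_le_ofReal hcoef
    _ ≤ ENNReal.ofReal (1 / (κ ^ 2 * endDist t) * (t ^ δ * (Real.pi - t) ^ δ)) *
        ∫⁻ s in Metric.ball (t : ℂ) (κ * endDist t), ‖f s‖ₑ ^ 2 := by gcongr
    _ = ∫⁻ s in Metric.ball (t : ℂ) (κ * endDist t),
        ENNReal.ofReal (1 / (κ ^ 2 * endDist t) * (t ^ δ * (Real.pi - t) ^ δ)) * ‖f s‖ₑ ^ 2 :=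
        (lintegral_const_mul' _ _ ENNReal.ofReal_ne_top).symm
    _ ≤ ∫⁻ s in Metric.ball (t : ℂ) (κ * endDist t), ENNReal.ofReal (4 ^ δ / (κ ^ 2 * endDist t)) *
          ENNReal.ofReal (‖f s‖ ^ 2 * bergmanWeight δ s) := by
        refine setLIntegral_mono' measurableSet_ball fun s hs ↦ ?_
        rw [hsq, ← ENNReal.ofReal_mul (by positivity), ← ENNReal.ofReal_mul (by positivity)]
        refine ENNReal.ofReal_le_ofReal ?_
        have hw := rpow_le_mul_bergmanWeight hδ hκ1 ht hs
        calc 1 / (κ ^ 2 * endDist t) * (t ^ δ * (Real.pi - t) ^ δ) * ‖f s‖ ^ 2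
            ≤ 1 / (κ ^ 2 * endDist t) * (4 ^ δ * bergmanWeight δ s) * ‖f s‖ ^ 2 := by gcongr
          _ = _ := by ring
    _ = _ := lintegral_const_mul' _ _ ENNReal.ofReal_ne_top

/-- If |x - t| < κ d(t) with κ ≤ 1/2, the Lipschitz bound gives d(x) ≤ 2 d(t) and |x - t| < d(x).
Hence the integrand is at most 2A / d(x) and lives on an interval of length 2 d(x). -/
theorem lintegral_endDist_kernel_le {κ x : ℝ} (hκ1 : κ ≤ 1 / 2) {A : ℝ}
    (hA : 0 ≤ A) :
    ∫⁻ t in Set.Ioo 0 Real.pi, (if |x - t| < κ * endDist t then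
      ENNReal.ofReal (A / endDist t) else 0) ≤ ENNReal.ofReal (4 * A) := by
  have hbound : ∀ t ∈ Set.Ioo 0 Real.pi, (if |x - t| < κ * endDist t then
      ENNReal.ofReal (A / endDist t) else 0) ≤
      (Set.Ioo (x - endDist x) (x + endDist x)).indicator
        (fun _ ↦ ENNReal.ofReal (2 * A / endDist x)) t := by
    intro t ht
    split_ifs with h
    · have hm := endDist_pos ht
      have hlip := abs_le.1 ((abs_endDist_sub_le x t).trans h.le)
      have hx : 0 < endDist x := by nlinarith
      have habs := abs_lt.1 h
      rw [Set.indicator_of_mem (Set.mem_Ioo.2 ⟨by nlinarith, by nlinarith⟩)]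
      refine ENNReal.ofReal_le_ofReal ?_
      rw [div_le_div_iff₀ hm hx]
      have hle : endDist x ≤ 2 * endDist t := by nlinarith
      calc A * endDist x ≤ A * (2 * endDist t) := by gcongr
        _ = 2 * A * endDist t := by ring
    · exact zero_le
  calc _ ≤ ∫⁻ t in Set.Ioo 0 Real.pi, (Set.Ioo (x - endDist x) (x + endDist x)).indicator
        (fun _ ↦ ENNReal.ofReal (2 * A / endDist x)) t :=
        setLIntegral_mono' measurableSet_Ioo hbound
    _ ≤ ∫⁻ t, (Set.Ioo (x - endDist x) (x + endDist x)).indicator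
        (fun _ ↦ ENNReal.ofReal (2 * A / endDist x)) t := setLIntegral_le_lintegral _ _
    _ ≤ ENNReal.ofReal (4 * A) := by
        rw [lintegral_indicator_const measurableSet_Ioo, Real.volume_Ioo]
        rcases le_or_gt (endDist x) 0 with hx | hx
        · rw [ENNReal.ofReal_of_nonpos (p := x + endDist x - (x - endDist x)) (by linarith), mul_zero]
          exact zero_le
        · rw [← ENNReal.ofReal_mul (by positivity)]
          refine ENNReal.ofReal_le_ofReal (le_of_eq ?_)
          field_simp
          ring

/-- The weighted restriction estimate in terms of lower Lebesgue integrals. -/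
theorem WeightedBergman.lintegral_Ioo_le {Θ δ κ : ℝ} (hδ : 0 ≤ δ) (hκ0 : 0 < κ)
    (hκ1 : κ ≤ 1 / 2) (hκ2 : κ ≤ Real.tan Θ * (1 - κ)) (f : WeightedBergman Θ δ) :
    ∫⁻ t in Set.Ioo 0 Real.pi,
        ENNReal.ofReal (t ^ (1 + δ) * (Real.pi - t) ^ (1 + δ) * ‖f (t : ℂ)‖ ^ 2)
      ≤ ENNReal.ofReal (4 * (4 ^ δ / κ ^ 2) * ‖f‖ ^ 2) := by
  set w : ℂ → ENNReal := fun s ↦ ENNReal.ofReal (‖f s‖ ^ 2 * bergmanWeight δ s) with hw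
  have hwm : Measurable w :=
    ((f.measurable.norm.pow_const 2).mul (measurable_bergmanWeight δ)).ennreal_ofReal
  -- The disc is enlarged to a vertical strip, so that after Tonelli the inner integral depends on
  -- Re s only.
  set k : ℝ → ℂ → ENNReal := fun t s ↦ (if |s.re - t| < κ * endDist t then
      ENNReal.ofReal (4 ^ δ / κ ^ 2 / endDist t) else 0) with hk
  have hkm : Measurable (Function.uncurry k) := by
    refine Measurable.ite ?_ ?_ measurable_const
    · exact measurableSet_lt (by fun_prop)
        ((continuous_endDist.measurable.comp measurable_fst).const_mul κ)
    · exact (measurable_const.div (continuous_endDist.measurable.comp measurable_fst)).ennreal_ofReal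
  calc _ ≤ ∫⁻ t in Set.Ioo 0 Real.pi, ∫⁻ s in rhombus Θ, k t s * w s := by
        refine setLIntegral_mono' measurableSet_Ioo fun t ht ↦ ?_
        refine (f.ofReal_le_lintegral_ball hδ hκ0 hκ1 hκ2 ht).trans ?_
        rw [← lintegral_const_mul' _ _ ENNReal.ofReal_ne_top]
        refine le_trans ?_ (lintegral_mono_set (ball_subset_rhombus (by linarith) hκ2 ht))
        refine setLIntegral_mono' measurableSet_ball fun s hs ↦ ?_
        have hre : |s.re - t| < κ * endDist t := by
          rw [Metric.mem_ball, dist_eq_norm] at hs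
          simpa using (Complex.abs_re_le_norm (s - t)).trans_lt hs
        simp only [hk, if_pos hre, div_div, hw, le_refl]
    _ = ∫⁻ s in rhombus Θ, ∫⁻ t in Set.Ioo 0 Real.pi, k t s * w s :=
        lintegral_lintegral_swap (hkm.mul (hwm.comp measurable_snd)).aemeasurable
    _ ≤ ∫⁻ s in rhombus Θ, ENNReal.ofReal (4 * (4 ^ δ / κ ^ 2)) * w s := by
        refine lintegral_mono fun s ↦ ?_
        rw [lintegral_mul_const' _ _ ENNReal.ofReal_ne_top]
        gcongr
        exact lintegral_endDist_kernel_le hκ1 (by positivity)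
    _ = _ := by
        rw [lintegral_const_mul' _ _ ENNReal.ofReal_ne_top, f.lintegral_eq,
          ← ENNReal.ofReal_mul (by positivity)]

theorem WeightedBergman.exists_integral_Ioo_le {Θ : ℝ} (hΘ : Θ ∈ Set.Ioo 0 (Real.pi / 2)) {δ : ℝ}
    (hδ : 0 ≤ δ) :
    ∃ C : ℝ, 0 < C ∧ ∀ f : WeightedBergman Θ δ,
      IntegrableOn (fun t : ℝ ↦ t ^ (1 + δ) * (Real.pi - t) ^ (1 + δ) * ‖f (t : ℂ)‖ ^ 2)
        (Set.Ioo 0 Real.pi) ∧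
      ∫ t in Set.Ioo 0 Real.pi, t ^ (1 + δ) * (Real.pi - t) ^ (1 + δ) * ‖f (t : ℂ)‖ ^ 2
        ≤ C * ‖f‖ ^ 2 := by
  have htan : 0 < Real.tan Θ := Real.tan_pos_of_pos_of_lt_pi_div_two hΘ.1 hΘ.2
  obtain ⟨κ, hκ0, hκ1, hκ2⟩ : ∃ κ : ℝ, 0 < κ ∧ κ ≤ 1 / 2 ∧ κ ≤ Real.tan Θ * (1 - κ) := by
    -- As 1 - κ ≥ 1/2, the bound κ ≤ tan Θ / 2 suffices.
    refine ⟨min (1 / 2) (Real.tan Θ / 2), by positivity, min_le_left _ _, ?_⟩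
    have h1 := min_le_left (1 / 2) (Real.tan Θ / 2)
    have h2 := min_le_right (1 / 2) (Real.tan Θ / 2)
    nlinarith
  refine ⟨4 * (4 ^ δ / κ ^ 2), by positivity, fun f ↦ ?_⟩
  have hle := f.lintegral_Ioo_le hδ hκ0 hκ1 hκ2
  have hnn : ∀ᵐ t : ℝ ∂volume.restrict (Set.Ioo 0 Real.pi),
      0 ≤ t ^ (1 + δ) * (Real.pi - t) ^ (1 + δ) * ‖f (t : ℂ)‖ ^ 2 := by
    filter_upwards [ae_restrict_mem measurableSet_Ioo] with t ht
    have h0 : 0 < t := ht.1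
    have h1 : 0 < Real.pi - t := sub_pos.2 ht.2
    positivity
  have hmeas : Measurable fun t : ℝ ↦
      t ^ (1 + δ) * (Real.pi - t) ^ (1 + δ) * ‖f (t : ℂ)‖ ^ 2 := by
    have := f.measurable.comp Complex.measurable_ofReal
    exact Measurable.mul (by fun_prop) (this.norm.pow_const 2)
  refine ⟨⟨hmeas.aestronglyMeasurable, ?_⟩, ?_⟩
  · rw [hasFiniteIntegral_iff_ofReal hnn]
    exact hle.trans_lt ENNReal.ofReal_lt_top
  · rw [integral_eq_lintegral_of_nonneg_ae hnn hmeas.aestronglyMeasurable]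
    exact ENNReal.toReal_le_of_le_ofReal (by positivity) hle

/-! ### Pointwise and Hardy-type bounds in W_0^{1,2} -/

theorem lintegral_mul_sq_le {α : Type*} [MeasurableSpace α] (μ : Measure α) {f g : α → ENNReal}
    (hf : AEMeasurable f μ) (hg : AEMeasurable g μ) :
    (∫⁻ a, f a * g a ∂μ) ^ 2 ≤ (∫⁻ a, f a ^ 2 ∂μ) * ∫⁻ a, g a ^ 2 ∂μ := by
  have h := ENNReal.lintegral_mul_le_Lp_mul_Lq μ Real.HolderConjugate.two_two hf hg
  simp only [Pi.mul_apply, ENNReal.rpow_two] at h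
  have hroot : ∀ x : ENNReal, (x ^ (1 / 2 : ℝ)) ^ 2 = x := fun x ↦ by
    rw [← ENNReal.rpow_two, ← ENNReal.rpow_mul]
    norm_num
  calc _ ≤ ((∫⁻ a, f a ^ 2 ∂μ) ^ (1 / 2 : ℝ) * (∫⁻ a, g a ^ 2 ∂μ) ^ (1 / 2 : ℝ)) ^ 2 := by gcongr
    _ = _ := by rw [mul_pow, hroot, hroot]

theorem enorm_sub_sq_le_mul_lintegral_deriv {φ : ℝ → ℂ} (hφ : ContDiff ℝ 1 φ) {a b : ℝ}
    (hab : a ≤ b) :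
    ‖φ b - φ a‖ₑ ^ 2 ≤ ENNReal.ofReal (b - a) * ∫⁻ x in Set.Ioc a b, ‖deriv φ x‖ₑ ^ 2 := by
  have hd : Continuous (deriv φ) := hφ.continuous_deriv (by norm_num)
  have hftc : ∫ x in a..b, deriv φ x = φ b - φ a :=
    intervalIntegral.integral_deriv_eq_sub (fun x _ ↦ hφ.differentiable (by norm_num) x)
      (hd.intervalIntegrable a b)
  rw [← hftc, intervalIntegral.integral_of_le hab]
  calc ‖∫ x in Set.Ioc a b, deriv φ x‖ₑ ^ 2
      ≤ (∫⁻ x in Set.Ioc a b, 1 * ‖deriv φ x‖ₑ) ^ 2 := by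
        gcongr
        simpa using enorm_integral_le_lintegral_enorm (μ := volume.restrict (Set.Ioc a b)) (deriv φ)
    _ ≤ (∫⁻ _ in Set.Ioc a b, 1 ^ 2) * ∫⁻ x in Set.Ioc a b, ‖deriv φ x‖ₑ ^ 2 :=
        lintegral_mul_sq_le _ aemeasurable_const hd.enorm.aemeasurable
    _ = _ := by simp

/-- The test function vanishes at both ends, so its derivative can be integrated from the nearer
one; Cauchy–Schwarz then produces the factor d(t). -/
theorem norm_sq_le_of_mem_testPairs {p : WithLp 2 (L2Interval × L2Interval)} (hp : p ∈ testPairs) :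
    ∀ᵐ t ∂volume.restrict (Set.Ioo 0 Real.pi), ‖p.fst t‖ ^ 2 ≤ endDist t * ‖p‖ ^ 2 := by
  obtain ⟨φ, hφ, -, hsupp, h1, h2⟩ := hp
  have hφ1 : ContDiff ℝ 1 φ := hφ.of_le (by exact_mod_cast le_top)
  have hφ0 : φ 0 = 0 := image_eq_zero_of_notMem_tsupport fun h ↦ lt_irrefl _ (hsupp h).1
  have hφπ : φ Real.pi = 0 := image_eq_zero_of_notMem_tsupport fun h ↦ lt_irrefl _ (hsupp h).2
  have hsnd : ∫⁻ x in Set.Ioo 0 Real.pi, ‖deriv φ x‖ₑ ^ 2 = ENNReal.ofReal (‖p.snd‖ ^ 2) := by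
    have h := eLpNorm_nnreal_pow_eq_lintegral (f := p.snd)
      (μ := volume.restrict (Set.Ioo 0 Real.pi)) (p := 2) (by norm_num)
    rw [ENNReal.ofReal_pow (norm_nonneg _), ofReal_norm, Lp.enorm_def]
    simp only [NNReal.coe_ofNat, ENNReal.rpow_ofNat, ENNReal.coe_ofNat] at h
    rw [h]
    exact lintegral_congr_ae (by filter_upwards [h2] with x hx; rw [hx])
  have hle : ‖p.snd‖ ^ 2 ≤ ‖p‖ ^ 2 := by gcongr; exact WithLp.norm_snd_le _ p
  filter_upwards [h1, ae_restrict_mem measurableSet_Ioo] with t ht htI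
  have hend := endDist_pos htI
  have key : ‖φ t‖ₑ ^ 2 ≤ ENNReal.ofReal (endDist t) * ENNReal.ofReal (‖p.snd‖ ^ 2) := by
    rw [← hsnd, endDist]
    rcases le_total t (Real.pi - t) with h | h
    · rw [min_eq_left h]
      have := enorm_sub_sq_le_mul_lintegral_deriv hφ1 htI.1.le
      rw [hφ0, sub_zero, sub_zero] at this
      refine this.trans ?_
      exact mul_le_mul_right (lintegral_mono_set (Set.Ioc_subset_Ioo_right htI.2)) _
    · rw [min_eq_right h]
      have := enorm_sub_sq_le_mul_lintegral_deriv hφ1 htI.2.le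
      rw [hφπ, zero_sub, enorm_neg] at this
      refine this.trans ?_
      rw [← restrict_Ioo_eq_restrict_Ioc]
      exact mul_le_mul_right (lintegral_mono_set (Set.Ioo_subset_Ioo_left htI.1.le)) _
  rw [ht]
  rw [← ofReal_norm, ← ENNReal.ofReal_pow (norm_nonneg _), ← ENNReal.ofReal_mul hend.le,
    ENNReal.ofReal_le_ofReal_iff (by positivity)] at key
  exact key.trans (by gcongr)

/-- An L² limit of test functions is an almost everywhere limit along a subsequence, and the
pointwise bound survives that limit. -/
theorem SobolevZero.norm_sq_le (ξ : SobolevZero) :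
    ∀ᵐ t ∂volume.restrict (Set.Ioo 0 Real.pi), ‖ξ.toL2 t‖ ^ 2 ≤ endDist t * ‖ξ‖ ^ 2 := by
  obtain ⟨p, hp, hlim⟩ := mem_closure_iff_seq_limit.1 ξ.2
  have hfst : Filter.Tendsto (fun n ↦ (p n).fst) Filter.atTop (nhds ξ.toL2) :=
    ((WithLp.fstL 2 ℂ L2Interval L2Interval).continuous.tendsto _).comp hlim
  obtain ⟨ns, hns, hae⟩ := (tendstoInMeasure_of_tendsto_Lp hfst).exists_seq_tendsto_ae
  have hbound := ae_all_iff.2 fun n ↦ norm_sq_le_of_mem_testPairs (hp n)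
  filter_upwards [hae, hbound] with t ht hb
  exact le_of_tendsto_of_tendsto (ht.norm.pow 2)
    (((hlim.comp hns.tendsto_atTop).norm.pow 2).const_mul _) (Filter.Eventually.of_forall fun n ↦ hb _)

theorem integrableOn_rpow_neg_add {δ : ℝ} (hδ : δ < 1) :
    IntegrableOn (fun t : ℝ ↦ t ^ (-δ) + (Real.pi - t) ^ (-δ)) (Set.Ioo 0 Real.pi) := by
  have h1 : IntervalIntegrable (fun t : ℝ ↦ t ^ (-δ)) volume 0 Real.pi :=
    intervalIntegral.intervalIntegrable_rpow' (by linarith)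
  have h2 := (h1.comp_sub_left Real.pi).symm
  rw [sub_self, sub_zero] at h2
  exact ((intervalIntegrable_iff_integrableOn_Ioo_of_le Real.pi_pos.le).1 (h1.add h2))

/-- Because π/2 > 1, d(t) ≤ t (π - t), and the quotient is at most d(t)^(-δ), which is one of the
two summands on the right. -/
theorem endDist_div_le {δ t : ℝ} (hδ : 0 ≤ δ) (ht : t ∈ Set.Ioo 0 Real.pi) :
    endDist t / (t ^ (1 + δ) * (Real.pi - t) ^ (1 + δ)) ≤ t ^ (-δ) + (Real.pi - t) ^ (-δ) := by
  have hm := endDist_pos ht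
  have h0 : 0 < t := ht.1
  have h1 : 0 < Real.pi - t := sub_pos.2 ht.2
  have hle : endDist t ≤ t * (Real.pi - t) := by
    nlinarith [endDist_le_mul ht, Real.pi_gt_three]
  calc endDist t / (t ^ (1 + δ) * (Real.pi - t) ^ (1 + δ))
      ≤ endDist t / endDist t ^ (1 + δ) := by
        rw [← Real.mul_rpow h0.le h1.le]
        gcongr
    _ = endDist t ^ (-δ) := by
        rw [div_eq_iff (by positivity), ← Real.rpow_add hm]
        ring_nf
        rw [Real.rpow_one]
    _ ≤ t ^ (-δ) + (Real.pi - t) ^ (-δ) := by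
        have ha : 0 ≤ t ^ (-δ) := by positivity
        have hb : 0 ≤ (Real.pi - t) ^ (-δ) := by positivity
        rcases min_choice t (Real.pi - t) with h | h
        · rw [endDist, h]; linarith
        · rw [endDist, h]; linarith

/-- A Hardy-type inequality for `W_0^{1,2}(0,π)`. -/
theorem SobolevZero.lintegral_div_le {δ : ℝ} (hδ0 : 0 ≤ δ) (hδ1 : δ < 1) (ξ : SobolevZero) :
    ∫⁻ t in Set.Ioo 0 Real.pi,
        ENNReal.ofReal (‖ξ.toL2 t‖ ^ 2 / (t ^ (1 + δ) * (Real.pi - t) ^ (1 + δ)))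
      ≤ ENNReal.ofReal
        ((∫ t in Set.Ioo 0 Real.pi, (t ^ (-δ) + (Real.pi - t) ^ (-δ))) * ‖ξ‖ ^ 2) := by
  have hnn : ∀ᵐ t : ℝ ∂volume.restrict (Set.Ioo 0 Real.pi), 0 ≤ t ^ (-δ) + (Real.pi - t) ^ (-δ) := by
    filter_upwards [ae_restrict_mem measurableSet_Ioo] with t ht
    have h0 : 0 < t := ht.1
    have h1 : 0 < Real.pi - t := sub_pos.2 ht.2
    positivity
  rw [ENNReal.ofReal_mul (integral_nonneg_of_ae hnn),
    ofReal_integral_eq_lintegral_ofReal (integrableOn_rpow_neg_add hδ1) hnn,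
    ← lintegral_mul_const' _ _ ENNReal.ofReal_ne_top]
  refine lintegral_mono_ae ?_
  filter_upwards [ξ.norm_sq_le, ae_restrict_mem measurableSet_Ioo, hnn] with t ht htI hnn
  rw [← ENNReal.ofReal_mul hnn]
  refine ENNReal.ofReal_le_ofReal ?_
  have h0 : 0 < t := htI.1
  have h1 : 0 < Real.pi - t := sub_pos.2 htI.2
  calc ‖ξ.toL2 t‖ ^ 2 / (t ^ (1 + δ) * (Real.pi - t) ^ (1 + δ))
      ≤ endDist t * ‖ξ‖ ^ 2 / (t ^ (1 + δ) * (Real.pi - t) ^ (1 + δ)) := by gcongr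
    _ = endDist t / (t ^ (1 + δ) * (Real.pi - t) ^ (1 + δ)) * ‖ξ‖ ^ 2 := by ring
    _ ≤ _ := by gcongr; exact endDist_div_le hδ0 htI

/-! ### The duality pairing -/

theorem lintegral_enorm_mul_sq_le {δ : ℝ} {f ξ : ℝ → ℂ}
    (hf : AEMeasurable f (volume.restrict (Set.Ioo 0 Real.pi)))
    (hξ : AEMeasurable ξ (volume.restrict (Set.Ioo 0 Real.pi))) :
    (∫⁻ t in Set.Ioo 0 Real.pi, ‖f t * ξ t‖ₑ) ^ 2 ≤
      (∫⁻ t in Set.Ioo 0 Real.pi,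
        ENNReal.ofReal (t ^ (1 + δ) * (Real.pi - t) ^ (1 + δ) * ‖f t‖ ^ 2)) *
      ∫⁻ t in Set.Ioo 0 Real.pi,
        ENNReal.ofReal (‖ξ t‖ ^ 2 / (t ^ (1 + δ) * (Real.pi - t) ^ (1 + δ))) := by
  -- Cauchy–Schwarz is applied to the factors u |f| and |ξ| / u.
  set u : ℝ → ℝ := fun t ↦ √(t ^ (1 + δ) * (Real.pi - t) ^ (1 + δ)) with hu
  have hum : Measurable u := by fun_prop
  have hpos : ∀ t ∈ Set.Ioo 0 Real.pi, 0 < t ^ (1 + δ) * (Real.pi - t) ^ (1 + δ) := by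
    intro t ht
    have h0 : 0 < t := ht.1
    have h1 : 0 < Real.pi - t := sub_pos.2 ht.2
    positivity
  calc (∫⁻ t in Set.Ioo 0 Real.pi, ‖f t * ξ t‖ₑ) ^ 2
      = (∫⁻ t in Set.Ioo 0 Real.pi, ENNReal.ofReal (u t * ‖f t‖) * ENNReal.ofReal (‖ξ t‖ / u t)) ^ 2 := by
        congr 1
        refine setLIntegral_congr_fun measurableSet_Ioo fun t ht ↦ ?_
        have hut : 0 < u t := Real.sqrt_pos.2 (hpos t ht)
        rw [← ENNReal.ofReal_mul (by positivity), ← ofReal_norm, norm_mul]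
        congr 1
        field_simp
    _ ≤ _ := lintegral_mul_sq_le _ (hum.aemeasurable.mul hf.norm).ennreal_ofReal
        (hξ.norm.div hum.aemeasurable).ennreal_ofReal
    _ = _ := by
        congr 1
        · refine setLIntegral_congr_fun measurableSet_Ioo fun t ht ↦ ?_
          rw [← ENNReal.ofReal_pow (by positivity), mul_pow, Real.sq_sqrt (hpos t ht).le]
        · refine setLIntegral_congr_fun measurableSet_Ioo fun t ht ↦ ?_
          rw [← ENNReal.ofReal_pow (by positivity), div_pow, Real.sq_sqrt (hpos t ht).le]

theorem WeightedBergman.exists_norm_integral_mul_le {Θ : ℝ} (hΘ : Θ ∈ Set.Ioo 0 (Real.pi / 2))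
    {δ : ℝ} (hδ0 : 0 ≤ δ) (hδ1 : δ < 1) :
    ∃ M : ℝ, ∀ (f : WeightedBergman Θ δ) (ξ : SobolevZero),
      IntegrableOn (fun x : ℝ ↦ f (x : ℂ) * ξ.toL2 x) (Set.Ioo 0 Real.pi) ∧
      ‖∫ x in Set.Ioo 0 Real.pi, f (x : ℂ) * ξ.toL2 x‖ ≤ M * ‖f‖ * ‖ξ‖ := by
  obtain ⟨C, hC, hCf⟩ := WeightedBergman.exists_integral_Ioo_le hΘ hδ0
  set H := ∫ t in Set.Ioo 0 Real.pi, (t ^ (-δ) + (Real.pi - t) ^ (-δ)) with hH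
  have hH0 : 0 ≤ H := setIntegral_nonneg measurableSet_Ioo fun t ht ↦ by
    have h0 : 0 < t := ht.1
    have h1 : 0 < Real.pi - t := sub_pos.2 ht.2
    positivity
  refine ⟨√(C * H), fun f ξ ↦ ?_⟩
  have hfm : Measurable fun x : ℝ ↦ f (x : ℂ) := f.measurable.comp Complex.measurable_ofReal
  have hξm := Lp.aestronglyMeasurable ξ.toL2
  have hnn : ∀ᵐ t : ℝ ∂volume.restrict (Set.Ioo 0 Real.pi),
      0 ≤ t ^ (1 + δ) * (Real.pi - t) ^ (1 + δ) * ‖f (t : ℂ)‖ ^ 2 := by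
    filter_upwards [ae_restrict_mem measurableSet_Ioo] with t ht
    have h0 : 0 < t := ht.1
    have h1 : 0 < Real.pi - t := sub_pos.2 ht.2
    positivity
  have hbound : ∫⁻ x in Set.Ioo 0 Real.pi, ‖f (x : ℂ) * ξ.toL2 x‖ₑ
      ≤ ENNReal.ofReal (√(C * H) * ‖f‖ * ‖ξ‖) := by
    rw [← ENNReal.pow_le_pow_left_iff two_ne_zero, ← ENNReal.ofReal_pow (by positivity)]
    refine (lintegral_enorm_mul_sq_le (δ := δ) hfm.aemeasurable hξm.aemeasurable).trans ?_
    refine (mul_le_mul' (b := ENNReal.ofReal (C * ‖f‖ ^ 2)) ?_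
      (ξ.lintegral_div_le hδ0 hδ1)).trans_eq ?_
    · rw [← ofReal_integral_eq_lintegral_ofReal (hCf f).1 hnn]
      exact ENNReal.ofReal_le_ofReal (hCf f).2
    · rw [← ENNReal.ofReal_mul (by positivity), mul_pow, mul_pow, Real.sq_sqrt (by positivity)]
      congr 1
      ring
  refine ⟨⟨hfm.aestronglyMeasurable.mul hξm, hbound.trans_lt ENNReal.ofReal_lt_top⟩, ?_⟩
  have h := (enorm_integral_le_lintegral_enorm _).trans hbound
  rwa [← ofReal_norm, ENNReal.ofReal_le_ofReal_iff (by positivity)] at h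

/-! ### Injectivity -/

/-- This supplies the connectedness that the identity theorem needs. -/
theorem convex_rhombus {Θ : ℝ} (hΘ : 0 ≤ Real.tan Θ) : Convex ℝ (rhombus Θ) := by
  rw [convex_iff_forall_pos]
  rintro x ⟨hx0, hx1, hx2⟩ y ⟨hy0, hy1, hy2⟩ a b ha hb hab
  rw [mul_min_of_nonneg _ _ hΘ, lt_min_iff] at hx2 hy2
  have hre : (a • x + b • y).re = a * x.re + b * y.re := by simp
  have him : (a • x + b • y).im = a * x.im + b * y.im := by simp
  have habs : |a * x.im + b * y.im| ≤ a * |x.im| + b * |y.im| := by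
    refine (abs_add_le _ _).trans_eq ?_
    rw [abs_mul, abs_mul, abs_of_pos ha, abs_of_pos hb]
  have hpi : Real.pi = a * Real.pi + b * Real.pi := by rw [← add_mul, hab, one_mul]
  refine ⟨?_, ?_, ?_⟩
  · rw [hre]; positivity
  · rw [hre, hpi]
    exact add_lt_add (mul_lt_mul_of_pos_left hx1 ha) (mul_lt_mul_of_pos_left hy1 hb)
  · rw [hre, him, mul_min_of_nonneg _ _ hΘ, lt_min_iff]
    refine ⟨habs.trans_lt ?_, habs.trans_lt ?_⟩
    · calc _ < a * (Real.tan Θ * x.re) + b * (Real.tan Θ * y.re) :=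
            add_lt_add (mul_lt_mul_of_pos_left hx2.1 ha) (mul_lt_mul_of_pos_left hy2.1 hb)
        _ = _ := by ring
    · calc _ < a * (Real.tan Θ * (Real.pi - x.re)) + b * (Real.tan Θ * (Real.pi - y.re)) :=
            add_lt_add (mul_lt_mul_of_pos_left hx2.2 ha) (mul_lt_mul_of_pos_left hy2.2 hb)
        _ = Real.tan Θ * ((a * Real.pi + b * Real.pi) - (a * x.re + b * y.re)) := by ring
        _ = _ := by rw [← hpi]

theorem ofReal_mem_rhombus {Θ t : ℝ} (hΘ : 0 < Real.tan Θ) (ht : t ∈ Set.Ioo 0 Real.pi) :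
    (t : ℂ) ∈ rhombus Θ := by
  refine mem_rhombus_iff.2 ⟨ht, ?_⟩
  simpa using mul_pos hΘ (endDist_pos ht)

/-- Identity theorem at π/2, an accumulation point of real zeros; outside the rhombus the
representative is zero by definition. -/
theorem WeightedBergman.eq_zero_of_forall_Ioo {Θ δ : ℝ} (hΘ : 0 < Real.tan Θ)
    (f : WeightedBergman Θ δ) (hf : ∀ t ∈ Set.Ioo 0 Real.pi, f ((t : ℝ) : ℂ) = 0) : f = 0 := by
  have hmid : Real.pi / 2 ∈ Set.Ioo 0 Real.pi := ⟨by positivity, by linarith [Real.pi_pos]⟩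
  have htend : Filter.Tendsto (fun t : ℝ ↦ (t : ℂ)) (nhdsWithin (Real.pi / 2) {Real.pi / 2}ᶜ)
      (nhdsWithin ((Real.pi / 2 : ℝ) : ℂ) {((Real.pi / 2 : ℝ) : ℂ)}ᶜ) := by
    refine tendsto_nhdsWithin_iff.2
      ⟨(Complex.continuous_ofReal.tendsto _).mono_left nhdsWithin_le_nhds, ?_⟩
    filter_upwards [self_mem_nhdsWithin] with t ht
    simpa using fun h ↦ ht (Complex.ofReal_injective (by simpa using h))
  have hev : ∀ᶠ t in nhdsWithin (Real.pi / 2) {Real.pi / 2}ᶜ, f ((t : ℝ) : ℂ) = 0 :=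
    Filter.Eventually.filter_mono nhdsWithin_le_nhds
      (Filter.mem_of_superset (isOpen_Ioo.mem_nhds hmid) hf)
  have hzero := (f.2.1.analyticOnNhd (isOpen_rhombus Θ)).eqOn_zero_of_preconnected_of_frequently_eq_zero
    (convex_rhombus hΘ.le).isPreconnected (ofReal_mem_rhombus hΘ hmid) (htend.frequently hev.frequently)
  apply Subtype.ext
  funext s
  by_cases hs : s ∈ rhombus Θ
  · exact hzero hs
  · exact f.2.2.2 s hs

/-- A real test function on `(0,π)`, as an element of `W_0^{1,2}(0,π)`. -/
theorem SobolevZero.exists_toL2_ae_eq {g : ℝ → ℝ} (hg : ContDiff ℝ (⊤ : ℕ∞) g)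
    (hc : HasCompactSupport g) (hs : tsupport g ⊆ Set.Ioo 0 Real.pi) :
    ∃ ξ : SobolevZero, ξ.toL2 =ᵐ[volume.restrict (Set.Ioo 0 Real.pi)] fun x ↦ (g x : ℂ) := by
  set φ : ℝ → ℂ := fun x ↦ (g x : ℂ) with hφ
  have hφs : ContDiff ℝ (⊤ : ℕ∞) φ := Complex.ofRealCLM.contDiff.comp hg
  have hφc : HasCompactSupport φ := hc.comp_left (g := fun x : ℝ ↦ (x : ℂ)) Complex.ofReal_zero
  have hφt : tsupport φ ⊆ Set.Ioo 0 Real.pi :=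
    (tsupport_comp_subset (g := fun x : ℝ ↦ (x : ℂ)) Complex.ofReal_zero g).trans hs
  have hd : Continuous (deriv φ) := hφs.continuous_deriv (by simp)
  have h1 : MemLp φ 2 (volume.restrict (Set.Ioo 0 Real.pi)) :=
    (hφs.continuous.memLp_of_hasCompactSupport hφc).restrict _
  have h2 : MemLp (deriv φ) 2 (volume.restrict (Set.Ioo 0 Real.pi)) :=
    (hd.memLp_of_hasCompactSupport hφc.deriv).restrict _
  exact ⟨⟨WithLp.toLp 2 (h1.toLp φ, h2.toLp (deriv φ)), subset_closure
    ⟨φ, hφs, hφc, hφt, h1.coeFn_toLp, h2.coeFn_toLp⟩⟩, h1.coeFn_toLp⟩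

/-- Real test functions already give f = 0 almost everywhere on (0,π), by the fundamental lemma of
the calculus of variations; continuity makes this hold at every point. -/
theorem WeightedBergman.eq_zero_of_integral_mul_eq_zero {Θ δ : ℝ} (hΘ : 0 < Real.tan Θ)
    (f : WeightedBergman Θ δ)
    (hf : ∀ ξ : SobolevZero, ∫ x in Set.Ioo 0 Real.pi, f (x : ℂ) * ξ.toL2 x = 0) : f = 0 := by
  have hcont : ContinuousOn (fun t : ℝ ↦ f (t : ℂ)) (Set.Ioo 0 Real.pi) :=
    f.2.1.continuousOn.comp Complex.continuous_ofReal.continuousOn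
      fun t ht ↦ ofReal_mem_rhombus hΘ ht
  have hae : ∀ᵐ t : ℝ, t ∈ Set.Ioo 0 Real.pi → f (t : ℂ) = 0 := by
    refine isOpen_Ioo.ae_eq_zero_of_integral_contDiff_smul_eq_zero
      (hcont.locallyIntegrableOn measurableSet_Ioo) fun g hg hc hs ↦ ?_
    obtain ⟨ξ, hξ⟩ := SobolevZero.exists_toL2_ae_eq hg hc hs
    rw [← setIntegral_eq_integral_of_forall_compl_eq_zero (s := Set.Ioo 0 Real.pi), ← hf ξ]
    · refine integral_congr_ae ?_
      filter_upwards [hξ] with x hx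
      rw [hx, Complex.real_smul, mul_comm]
    · intro x hx
      rw [image_eq_zero_of_notMem_tsupport fun h ↦ hx (hs h), zero_smul]
  refine f.eq_zero_of_forall_Ioo hΘ (Measure.eqOn_open_of_ae_eq (μ := volume)
    (g := fun _ ↦ (0 : ℂ)) ?_ isOpen_Ioo hcont continuousOn_const)
  exact (ae_restrict_iff' measurableSet_Ioo).2 hae

/-! ### The embedding into W^{-1,2} and the conclusion -/

theorem WeightedBergman.exists_continuousLinearMap_sobolevNeg {Θ : ℝ}
    (hΘ : Θ ∈ Set.Ioo 0 (Real.pi / 2)) {δ : ℝ} (hδ0 : 0 ≤ δ) (hδ1 : δ < 1) :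
    ∃ J : WeightedBergman Θ δ →L[ℂ] SobolevNeg, Function.Injective J ∧
      ∀ (f : WeightedBergman Θ δ) (ξ : SobolevZero),
        IntegrableOn (fun x : ℝ ↦ f (x : ℂ) * SobolevZero.toL2 ξ x) (Set.Ioo 0 Real.pi) ∧
        J f ξ = ∫ x in Set.Ioo 0 Real.pi, f (x : ℂ) * SobolevZero.toL2 ξ x := by
  obtain ⟨M, hM⟩ := WeightedBergman.exists_norm_integral_mul_le hΘ hδ0 hδ1
  let B : WeightedBergman Θ δ →ₗ[ℂ] SobolevZero →ₗ[ℂ] ℂ :=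
    LinearMap.mk₂ ℂ (fun f ξ ↦ ∫ x in Set.Ioo 0 Real.pi, f (x : ℂ) * SobolevZero.toL2 ξ x)
      (fun f g ξ ↦ by
        rw [← integral_add (hM f ξ).1 (hM g ξ).1]
        exact integral_congr_ae (Filter.Eventually.of_forall fun x ↦ add_mul _ _ _))
      (fun c f ξ ↦ by
        rw [smul_eq_mul, ← integral_const_mul]
        exact integral_congr_ae (Filter.Eventually.of_forall fun x ↦ mul_assoc c _ _))
      (fun f ξ η ↦ by
        rw [← integral_add (hM f ξ).1 (hM f η).1]
        refine integral_congr_ae ?_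
        filter_upwards [Lp.coeFn_add ξ.toL2 η.toL2] with x hx
        rw [← mul_add]
        exact congrArg _ hx)
      (fun c f ξ ↦ by
        rw [smul_eq_mul, ← integral_const_mul]
        refine integral_congr_ae ?_
        filter_upwards [Lp.coeFn_smul c ξ.toL2] with x hx
        rw [mul_left_comm]
        exact congrArg _ hx)
  let J : WeightedBergman Θ δ →L[ℂ] SobolevNeg := B.mkContinuous₂ M fun f ξ ↦ (hM f ξ).2
  refine ⟨J, (injective_iff_map_eq_zero J).2 fun f hf ↦ ?_, fun f ξ ↦ ⟨(hM f ξ).1, rfl⟩⟩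
  refine f.eq_zero_of_integral_mul_eq_zero (Real.tan_pos_of_pos_of_lt_pi_div_two hΘ.1 hΘ.2)
    fun ξ ↦ ?_
  exact congrArg (fun T : SobolevNeg ↦ T ξ) hf

theorem proposition5p1 (Θ : ℝ) (hΘ : Θ ∈ Set.Ioo 0 (Real.pi / 2))
    (δ : ℝ) (hδ : δ ∈ Set.Ioo (0 : ℝ) 1) :
    (∃ C : ℝ, 0 < C ∧ ∀ f : WeightedBergman Θ δ,
      IntegrableOn (fun t : ℝ ↦ t ^ (1 + δ) * (Real.pi - t) ^ (1 + δ) * ‖f (t : ℂ)‖ ^ 2)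
        (Set.Ioo 0 Real.pi) ∧
      ∫ t in Set.Ioo 0 Real.pi, t ^ (1 + δ) * (Real.pi - t) ^ (1 + δ) * ‖f (t : ℂ)‖ ^ 2
        ≤ C * ‖f‖ ^ 2) ∧
    (∃ J : WeightedBergman Θ δ →L[ℂ] SobolevNeg, Function.Injective J ∧
      ∀ (f : WeightedBergman Θ δ) (ξ : SobolevZero),
        IntegrableOn (fun x : ℝ ↦ f (x : ℂ) * SobolevZero.toL2 ξ x) (Set.Ioo 0 Real.pi) ∧
        J f ξ = ∫ x in Set.Ioo 0 Real.pi, f (x : ℂ) * SobolevZero.toL2 ξ x) :=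
  ⟨WeightedBergman.exists_integral_Ioo_le hΘ hδ.1.le,
    WeightedBergman.exists_continuousLinearMap_sobolevNeg hΘ hδ.1.le hδ.2⟩
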